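/- Let $\mathbb{L}^{n+2}=\mathbb{R}\times\mathbb{R}^{n+1}$ carry the Lorentzian metric $\langle\,,\rangle=-dt^2+dx_1^2+\dots+dx_{n+1}^2$. Let $J\subset\mathbb{R}$ be an open interval and let $r\in C^\infty(J)$ satisfy $r>0$ and $|r'|<1$ on $J$. Put $$Q(r)=\Big\{(t,x)\in J\times\mathbb{R}^{n+1}:\ \sum_{i=1}^{n+1}x_i^2=r(t)^2\Big\}\subset\mathbb{L}^{n+2},$$ a Lorentzian hypersurface of $\mathbb{L}^{n+2}$. Let $M^k$ be a smooth manifold of dimension $k\ge 1$ and let $\Psi=(\Psi_0,\Psi_1,\dots,\Psi_{n+1}):M^k\to Q(r)\subset\mathbb{L}^{n+2}$ be a smooth spacelike immersion, i.e. the induced metric on $M^k$ is Riemannian. Let $\nabla$, $\Delta$ and $\|\cdot\|$ denote the gradient, the Laplacian and the norm of the induced metric, and set $$q_{\Psi_0}=\frac{k-\big(r''(\Psi_0)\,r(\Psi_0)+r'(\Psi_0)^2-1\big)\|\nabla\Psi_0\|^2}{r(\Psi_0)^2\,\big(1-r'(\Psi_0)^2\big)}.$$ Suppose that $\Psi$ is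 stationary, i.e. the mean curvature vector field of $\Psi:M^k\to Q(r)$ vanishes identically. Then: 1. If the function $r(\Psi_0)^2$ on $M^k$ attains a local maximum at $x\in M^k$, then $q_{\Psi_0}(x)>0$. 2. On all of $M^k$, $$\tfrac12\,\Delta\, r(\Psi_0)^2+q_{\Psi_0}\,r(\Psi_0)^2=\sum_{j=1}^{n+1}\|\nabla\Psi_j\|^2>0.$$ -/

import Mathlib

open scoped Manifold ContDiff

noncomputable section

namespace SpacelikeRW

/-- The underlying vector space `ℝ × ℝ^{n+1}` of the Lorentz-Minkowski spacetime `𝕃^{n+2}`,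
with points written `(t, x)`. -/
abbrev LM (n : ℕ) : Type := ℝ × EuclideanSpace ℝ (Fin (n + 1))

/-- The Lorentzian scalar product `-(dt)² + (dx₁)² + ⋯ + (dx_{n+1})²` of `𝕃^{n+2}`. -/
def lorentz {n : ℕ} (v w : LM n) : ℝ := -(v.1 * w.1) + ∑ j, v.2 j * w.2 j

/-- `r ∈ C^∞(J)` is admissible on the open interval `J`: `r > 0` and `|r'| < 1` on `J`. -/
structure IsAdmissible (J : Set ℝ) (r : ℝ → ℝ) : Prop where
  isOpen : IsOpen J
  ordConnected : J.OrdConnected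
  contDiffOn : ContDiffOn ℝ ∞ r J
  pos : ∀ t ∈ J, 0 < r t
  abs_deriv_lt_one : ∀ t ∈ J, |deriv r t| < 1

/-- The rotation hypersurface `Q(r) = {(t, x) : t ∈ J, ∑ xᵢ² = r(t)²}` of `𝕃^{n+2}`. -/
def Q (n : ℕ) (J : Set ℝ) (r : ℝ → ℝ) : Set (LM n) :=
  {p | p.1 ∈ J ∧ ∑ j, p.2 j ^ 2 = r p.1 ^ 2}

/-- The unit spacelike normal `N(t, x) = (r'(t) r(t), x) / (r(t) √(1 - r'(t)²))` of `Q(r)`. -/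
def unitNormal {n : ℕ} (r : ℝ → ℝ) (p : LM n) : LM n :=
  (1 / (r p.1 * √(1 - deriv r p.1 ^ 2))) • ((deriv r p.1 * r p.1, p.2) : LM n)

/-- The orthogonal projection of `w ∈ 𝕃^{n+2}` onto the tangent space `N(p)^⊥` of `Q(r)` at `p`.
Applied to the flat derivative of a tangent field it gives the Levi-Civita connection of `Q(r)`. -/
def projQ {n : ℕ} (r : ℝ → ℝ) (p w : LM n) : LM n :=
  w - lorentz w (unitNormal r p) • unitNormal r p

/-! ### Riemannian geometry in local coordinates -/

section Coordinates

variable {k : ℕ}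

/-- The partial derivative `∂ᵢ f` at the point `u` of the coordinate space `ℝ^k`. -/
def pd {F : Type*} [NormedAddCommGroup F] [NormedSpace ℝ F] (i : Fin k)
    (f : EuclideanSpace ℝ (Fin k) → F) (u : EuclideanSpace ℝ (Fin k)) : F :=
  fderiv ℝ f u (EuclideanSpace.single i 1)

/-- The Christoffel symbol
`Γ^l_{ij} = ½ ∑ₘ g^{lm} (∂ᵢ g_{jm} + ∂ⱼ g_{im} - ∂ₘ g_{ij})` of the metric `g`. -/
def christoffel (g : EuclideanSpace ℝ (Fin k) → Matrix (Fin k) (Fin k) ℝ) (l i j : Fin k)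
    (u : EuclideanSpace ℝ (Fin k)) : ℝ :=
  (1 / 2) * ∑ m, (g u)⁻¹ l m *
    (pd i (fun v => g v j m) u + pd j (fun v => g v i m) u - pd m (fun v => g v i j) u)

/-- The Hessian `(∇²f)(∂ᵢ, ∂ⱼ) = ∂ᵢ∂ⱼ f - ∑ₗ Γ^l_{ij} ∂ₗ f` with respect to the metric `g`. -/
def coordHess (g : EuclideanSpace ℝ (Fin k) → Matrix (Fin k) (Fin k) ℝ)
    (f : EuclideanSpace ℝ (Fin k) → ℝ) (i j : Fin k) (u : EuclideanSpace ℝ (Fin k)) : ℝ :=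
  pd i (pd j f) u - ∑ l, christoffel g l i j u * pd l f u

/-- The Laplacian `∑ g^{ij} (∇²f)(∂ᵢ, ∂ⱼ)` with respect to the metric `g`. -/
def coordLaplacian (g : EuclideanSpace ℝ (Fin k) → Matrix (Fin k) (Fin k) ℝ)
    (f : EuclideanSpace ℝ (Fin k) → ℝ) (u : EuclideanSpace ℝ (Fin k)) : ℝ :=
  ∑ i, ∑ j, (g u)⁻¹ i j * coordHess g f i j u

/-- The squared norm `∑ g^{ij} ∂ᵢf ∂ⱼf` of the gradient with respect to the metric `g`. -/
def coordGradSq (g : EuclideanSpace ℝ (Fin k) → Matrix (Fin k) (Fin k) ℝ)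
    (f : EuclideanSpace ℝ (Fin k) → ℝ) (u : EuclideanSpace ℝ (Fin k)) : ℝ :=
  ∑ i, ∑ j, (g u)⁻¹ i j * (pd i f u * pd j f u)

end Coordinates

/-! ### Spacelike submanifolds -/

section Immersion

variable {n k : ℕ} {M : Type*} [TopologicalSpace M] [ChartedSpace (EuclideanSpace ℝ (Fin k)) M]

/-- `Ψ : M^k → 𝕃^{n+2}` is a spacelike immersion: it is smooth, its differential is injective at
every point and the induced metric is Riemannian (positive definite). -/
structure IsSpacelikeImmersion (Ψ : M → LM n) : Prop where
  contMDiff : ContMDiff (𝓡 k) 𝓘(ℝ, LM n) ∞ Ψ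
  injective : ∀ x : M, Function.Injective (mfderiv (𝓡 k) 𝓘(ℝ, LM n) Ψ x)
  pos : ∀ (x : M) (v : TangentSpace (𝓡 k) x), v ≠ 0 →
    0 < lorentz (n := n) (mfderiv (𝓡 k) 𝓘(ℝ, LM n) Ψ x v) (mfderiv (𝓡 k) 𝓘(ℝ, LM n) Ψ x v)

/-- The expression of `f : M → F` in the preferred chart at `x`. -/
def inChart {F : Type*} (x : M) (f : M → F) : EuclideanSpace ℝ (Fin k) → F :=
  fun u => f ((extChartAt (𝓡 k) x).symm u)

/-- The coefficients `g_{ij} = ⟨∂ᵢΨ, ∂ⱼΨ⟩` of the induced metric in the preferred chart at `x`. -/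
def inducedMetric (Ψ : M → LM n) (x : M) (u : EuclideanSpace ℝ (Fin k)) :
    Matrix (Fin k) (Fin k) ℝ :=
  Matrix.of fun i j => lorentz (pd i (inChart x Ψ) u) (pd j (inChart x Ψ) u)

/-- The Laplacian `Δf` on `M`, with respect to the metric induced by `Ψ`. It does not depend on
the coordinates; at `x` it is computed in the preferred chart at `x`. -/
def laplacian (Ψ : M → LM n) (f : M → ℝ) (x : M) : ℝ :=
  coordLaplacian (inducedMetric (k := k) Ψ x) (inChart x f) (extChartAt (𝓡 k) x x)

/-- The squared norm `‖∇f‖²` of the gradient on `M`, with respect to the metric induced by `Ψ`. -/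
def gradSq (Ψ : M → LM n) (f : M → ℝ) (x : M) : ℝ :=
  coordGradSq (inducedMetric (k := k) Ψ x) (inChart x f) (extChartAt (𝓡 k) x x)

/-- The component of `w ∈ 𝕃^{n+2}` tangent to `M` at `x`, that is `∑ g^{lm} ⟨w, ∂ₗΨ⟩ ∂ₘΨ`. -/
def tangentPart (Ψ : M → LM n) (x : M) (w : LM n) : LM n :=
  ∑ l : Fin k, ∑ m : Fin k,
    ((inducedMetric Ψ x (extChartAt (𝓡 k) x x))⁻¹ l m *
        lorentz w (pd l (inChart x Ψ) (extChartAt (𝓡 k) x x))) •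
      pd m (inChart x Ψ) (extChartAt (𝓡 k) x x)

/-- The covariant derivative in `Q(r)` of the coordinate field `∂ⱼΨ` in the direction `∂ᵢΨ`. -/
def covDeriv (r : ℝ → ℝ) (Ψ : M → LM n) (x : M) (i j : Fin k) : LM n :=
  projQ r (Ψ x) (pd i (pd j (inChart x Ψ)) (extChartAt (𝓡 k) x x))

/-- The second fundamental form of `Ψ : M^k → Q(r)` on the coordinate fields `∂ᵢ, ∂ⱼ` at `x`: the
component normal to `M` of the covariant derivative in `Q(r)`. -/
def secondFundamentalForm (r : ℝ → ℝ) (Ψ : M → LM n) (x : M) (i j : Fin k) : LM n :=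
  covDeriv r Ψ x i j - tangentPart (k := k) Ψ x (covDeriv r Ψ x i j)

/-- The mean curvature vector field of `Ψ : M^k → Q(r)`: `1/k` times the metric trace of the second
fundamental form. -/
def meanCurvature (r : ℝ → ℝ) (Ψ : M → LM n) (x : M) : LM n :=
  (1 / (k : ℝ)) • ∑ i : Fin k, ∑ j : Fin k,
    (inducedMetric Ψ x (extChartAt (𝓡 k) x x))⁻¹ i j • secondFundamentalForm r Ψ x i j

/-- `Ψ : M^k → Q(r)` is stationary: its mean curvature vector field in `Q(r)` vanishes. -/
def IsStationary (k : ℕ) [ChartedSpace (EuclideanSpace ℝ (Fin k)) M]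
    (r : ℝ → ℝ) (Ψ : M → LM n) : Prop :=
  ∀ x : M, meanCurvature (k := k) r Ψ x = 0

/-- The function `q_{Ψ₀} = (k - (r''(Ψ₀) r(Ψ₀) + r'(Ψ₀)² - 1) ‖∇Ψ₀‖²) / (r(Ψ₀)² (1 - r'(Ψ₀)²))`
on `M^k`. -/
def qFun (k : ℕ) [ChartedSpace (EuclideanSpace ℝ (Fin k)) M]
    (r : ℝ → ℝ) (Ψ : M → LM n) (x : M) : ℝ :=
  ((k : ℝ) - (deriv (deriv r) (Ψ x).1 * r (Ψ x).1 + deriv r (Ψ x).1 ^ 2 - 1) *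
      gradSq (k := k) Ψ (fun y => (Ψ y).1) x) /
    (r (Ψ x).1 ^ 2 * (1 - deriv r (Ψ x).1 ^ 2))

end Immersion

end SpacelikeRW

end

/-! The vector Laplacian of `Ψ` is the metric trace of the part of `∂ᵢ∂ⱼΨ` normal to `M`, since the
Christoffel terms subtract exactly the tangent part. Vanishing mean curvature in `Q(r)` therefore
leaves only the direction normal to `Q(r)`: `ΔΨ = c • (r'r, x)` for some real `c` at each point
(`IsStationary.exists_vecLaplacian_eq`).

Hence `ΔΨ₀ = c r'r` and `ΔΨⱼ = cΨⱼ`, and `½ Δ r(Ψ₀)²` can be computed in two ways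
(`laplacian_sq_radius`): from `∑ Ψⱼ²` it is `∑ ‖∇Ψⱼ‖² + c r²`, and by the chain rule it is `(r'² + r
r'')‖∇Ψ₀‖² + c r² r'²`. The trace of `g⁻¹g` gives `∑ ‖∇Ψⱼ‖² = k + ‖∇Ψ₀‖²` (`sum_coordGradSq_sub`).
Equating the two and dividing by `r²(1 - r'²)` yields `c = -q`, so the first expression is the
claimed identity, and its right side is at least `k > 0`.

At a local maximum the Laplacian is nonpositive (`coordLaplacian_nonpos_of_isLocalMax`), so the
identity forces `q r² > 0`. -/

open Filter Topology

namespace SpacelikeRW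

/-! ### The Lorentzian scalar product -/

section Lorentz

variable {n : ℕ}

/-- The Lorentzian scalar product as a continuous bilinear map. -/
noncomputable def lorentzL (n : ℕ) : LM n →L[ℝ] LM n →L[ℝ] ℝ :=
  LinearMap.toContinuousBilinearMap <|
    LinearMap.mk₂ ℝ (lorentz (n := n))
      (fun v v' w => by
        simp only [lorentz, Prod.fst_add, Prod.snd_add, PiLp.add_apply, add_mul,
          Finset.sum_add_distrib]; ring)
      (fun c v w => by
        simp only [lorentz, Prod.smul_fst, Prod.smul_snd, PiLp.smul_apply, smul_eq_mul, mul_add,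
          Finset.mul_sum, mul_assoc]; ring)
      (fun v w w' => by
        simp only [lorentz, Prod.fst_add, Prod.snd_add, PiLp.add_apply, mul_add,
          Finset.sum_add_distrib]; ring)
      (fun c v w => by
        simp only [lorentz, Prod.smul_fst, Prod.smul_snd, PiLp.smul_apply, smul_eq_mul, mul_add,
          Finset.mul_sum, mul_left_comm]; ring)

lemma lorentzL_apply (v w : LM n) : lorentzL n v w = lorentz v w := rfl

lemma lorentz_comm (v w : LM n) : lorentz v w = lorentz w v := by
  simp only [lorentz, mul_comm]

end Lorentz

section Coordinates

variable {k n : ℕ} {F : Type*} [NormedAddCommGroup F] [NormedSpace ℝ F]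

local notation "E" => EuclideanSpace ℝ (Fin k)

/-! ### Calculus rules for coordinate derivatives -/

lemma contDiffAt_pd {f : E → F} {u : E} (hf : ContDiffAt ℝ 2 f u) (i : Fin k) :
    ContDiffAt ℝ 1 (pd i f) u :=
  (hf.fderiv_right (m := 1) (by norm_num)).clm_apply contDiffAt_const

lemma pd_pd_apply {f : E → F} {u : E} (hf : ContDiffAt ℝ 2 f u) (i j : Fin k) :
    pd i (pd j f) u =
      fderiv ℝ (fderiv ℝ f) u (EuclideanSpace.single i 1) (EuclideanSpace.single j 1) := by
  have h : DifferentiableAt ℝ (fderiv ℝ f) u :=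
    (hf.fderiv_right (m := 1) (by norm_num)).differentiableAt (by norm_num)
  have := h.hasFDerivAt.clm_apply (hasFDerivAt_const (EuclideanSpace.single j (1 : ℝ)) u)
  simp only [pd]
  erw [this.fderiv]
  simp

lemma pd_pd_comm {f : E → F} {u : E} (hf : ContDiffAt ℝ 2 f u) (i j : Fin k) :
    pd i (pd j f) u = pd j (pd i f) u := by
  rw [pd_pd_apply hf, pd_pd_apply hf]
  exact hf.isSymmSndFDerivAt (by simp) _ _

lemma pd_clm {G : Type*} [NormedAddCommGroup G] [NormedSpace ℝ G] (ℓ : F →L[ℝ] G) {f : E → F}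
    {u : E} (hf : DifferentiableAt ℝ f u) (i : Fin k) :
    pd i (fun v => ℓ (f v)) u = ℓ (pd i f u) := by
  have := ℓ.hasFDerivAt.comp u hf.hasFDerivAt
  simp only [pd]
  erw [this.fderiv]
  simp

lemma pd_pd_clm {G : Type*} [NormedAddCommGroup G] [NormedSpace ℝ G] (ℓ : F →L[ℝ] G) {f : E → F}
    {u : E} (hf : ContDiffAt ℝ 2 f u) (i j : Fin k) :
    pd i (pd j (fun v => ℓ (f v))) u = ℓ (pd i (pd j f) u) := by
  have h : pd j (fun v => ℓ (f v)) =ᶠ[𝓝 u] fun v => ℓ (pd j f v) := by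
    filter_upwards [hf.eventually (by simp)] with v hv
    exact pd_clm ℓ (hv.differentiableAt (by norm_num)) j
  rw [pd, h.fderiv_eq]
  exact pd_clm ℓ ((contDiffAt_pd hf j).differentiableAt (by norm_num)) i

lemma pd_comp {h : ℝ → ℝ} {f : E → ℝ} {u : E} (hh : DifferentiableAt ℝ h (f u))
    (hf : DifferentiableAt ℝ f u) (i : Fin k) :
    pd i (fun v => h (f v)) u = deriv h (f u) * pd i f u := by
  have := hh.hasDerivAt.comp_hasFDerivAt u hf.hasFDerivAt
  simp only [pd]
  erw [this.fderiv]
  simp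

lemma pd_mul {f g : E → ℝ} {u : E} (hf : DifferentiableAt ℝ f u)
    (hg : DifferentiableAt ℝ g u) (i : Fin k) :
    pd i (fun v => f v * g v) u = pd i f u * g u + f u * pd i g u := by
  simp only [pd]
  rw [fderiv_fun_mul hf hg]
  simp
  ring

lemma pd_pd_comp {h : ℝ → ℝ} {f : E → ℝ} {u : E} (hh : ContDiffAt ℝ 2 h (f u))
    (hf : ContDiffAt ℝ 2 f u) (i j : Fin k) :
    pd i (pd j (fun v => h (f v))) u =
      deriv (deriv h) (f u) * (pd i f u * pd j f u) + deriv h (f u) * pd i (pd j f) u := by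
  have e : pd j (fun v => h (f v)) =ᶠ[𝓝 u] fun v => deriv h (f v) * pd j f v := by
    filter_upwards [hf.eventually (by simp),
      hf.continuousAt.eventually (hh.eventually (by simp))] with v hv hv'
    exact pd_comp (hv'.differentiableAt (by norm_num)) (hv.differentiableAt (by norm_num)) j
  have hd : DifferentiableAt ℝ (deriv h) (f u) := by
    have : ContDiffAt ℝ 1 (deriv h) (f u) :=
      (hh.fderiv_right (m := 1) (by norm_num)).clm_apply contDiffAt_const
    exact this.differentiableAt (by norm_num)
  have hf1 := hf.differentiableAt (by norm_num)
  rw [pd, e.fderiv_eq]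
  change pd i _ u = _
  rw [pd_mul (f := fun v => deriv h (f v)) (hd.comp u hf1) ((contDiffAt_pd hf j).differentiableAt (by norm_num)),
    pd_comp hd hf1]
  ring

lemma pd_lorentz {A B : E → LM n} {u : E} (hA : DifferentiableAt ℝ A u)
    (hB : DifferentiableAt ℝ B u) (i : Fin k) :
    pd i (fun v => lorentz (A v) (B v)) u = lorentz (pd i A u) (B u) + lorentz (A u) (pd i B u) := by
  have := (lorentzL n).hasFDerivAt_of_bilinear hA.hasFDerivAt hB.hasFDerivAt
  simp only [pd]
  erw [this.fderiv]
  simp [lorentzL_apply]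
  ring

/-! ### The Laplacian in coordinates -/

/-- The Christoffel term is linear in first derivatives, so the chain rule produces the gradient
term only through `∂ᵢ∂ⱼ`. Any matrix field `g` will do. -/
lemma coordLaplacian_comp (g : E → Matrix (Fin k) (Fin k) ℝ) {h : ℝ → ℝ} {f : E → ℝ} {u : E}
    (hh : ContDiffAt ℝ 2 h (f u)) (hf : ContDiffAt ℝ 2 f u) :
    coordLaplacian g (fun v => h (f v)) u =
      deriv (deriv h) (f u) * coordGradSq g f u + deriv h (f u) * coordLaplacian g f u := by
  simp only [coordLaplacian, coordGradSq, coordHess, pd_pd_comp hh hf,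
    pd_comp (hh.differentiableAt (by norm_num)) (hf.differentiableAt (by norm_num)),
    Finset.mul_sum, ← Finset.sum_add_distrib]
  refine Finset.sum_congr rfl fun i _ => Finset.sum_congr rfl fun j _ => ?_
  have : ∑ l, christoffel g l i j u * (deriv h (f u) * pd l f u) =
      deriv h (f u) * ∑ l, christoffel g l i j u * pd l f u := by
    rw [Finset.mul_sum]
    exact Finset.sum_congr rfl fun l _ => by ring
  rw [this]
  ring

lemma coordLaplacian_sum (g : E → Matrix (Fin k) (Fin k) ℝ) {ι : Type*} (s : Finset ι)
    {f : ι → E → ℝ} {u : E} (hf : ∀ a ∈ s, ContDiffAt ℝ 2 (f a) u) :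
    coordLaplacian g (fun v => ∑ a ∈ s, f a v) u = ∑ a ∈ s, coordLaplacian g (f a) u := by
  have h1 : ∀ v, (∀ a ∈ s, ContDiffAt ℝ 2 (f a) v) → ∀ i,
      pd i (fun v => ∑ a ∈ s, f a v) v = ∑ a ∈ s, pd i (f a) v := by
    intro v hv i
    simp only [pd]
    rw [fderiv_fun_sum fun a ha => (hv a ha).differentiableAt (by norm_num)]
    simp
  have h2 : ∀ i j, pd i (pd j (fun v => ∑ a ∈ s, f a v)) u = ∑ a ∈ s, pd i (pd j (f a)) u := by
    intro i j
    have e : pd j (fun v => ∑ a ∈ s, f a v) =ᶠ[𝓝 u] fun v => ∑ a ∈ s, pd j (f a) v := by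
      filter_upwards [(Filter.eventually_all_finset s).2 fun a ha =>
        (hf a ha).eventually (by simp)] with v hv
      exact h1 v hv j
    rw [pd, e.fderiv_eq, fderiv_fun_sum fun a ha =>
      (contDiffAt_pd (hf a ha) j).differentiableAt (by norm_num)]
    simp [pd]
  simp only [coordLaplacian, coordHess, h2, h1 u hf]
  rw [Finset.sum_comm (s := s)]
  refine Finset.sum_congr rfl fun i _ => ?_
  rw [Finset.sum_comm (s := s)]
  refine Finset.sum_congr rfl fun j _ => ?_
  rw [← Finset.mul_sum, Finset.sum_sub_distrib]
  congr 2
  simp only [Finset.mul_sum]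
  exact Finset.sum_comm

/-- The Laplacian of a vector-valued function with respect to the metric `g`. -/
noncomputable def vecLaplacian (g : E → Matrix (Fin k) (Fin k) ℝ) (f : E → F) (u : E) : F :=
  ∑ i, ∑ j, (g u)⁻¹ i j • (pd i (pd j f) u - ∑ l, christoffel g l i j u • pd l f u)

lemma coordLaplacian_clm (g : E → Matrix (Fin k) (Fin k) ℝ) (ℓ : F →L[ℝ] ℝ) {f : E → F} {u : E}
    (hf : ContDiffAt ℝ 2 f u) :
    coordLaplacian g (fun v => ℓ (f v)) u = ℓ (vecLaplacian g f u) := by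
  simp only [coordLaplacian, coordHess, vecLaplacian, pd_pd_clm ℓ hf,
    pd_clm ℓ (hf.differentiableAt (by norm_num)), map_sum, map_smul, map_sub, smul_eq_mul]

/-! ### The induced metric -/

/-- The coefficients `⟨∂ᵢΦ, ∂ⱼΦ⟩` of the metric induced by a parametrization `Φ`. -/
noncomputable def pullbackMetric (Φ : E → LM n) (u : E) : Matrix (Fin k) (Fin k) ℝ :=
  Matrix.of fun i j => lorentz (pd i Φ u) (pd j Φ u)

lemma pullbackMetric_transpose (Φ : E → LM n) (u : E) :
    (pullbackMetric Φ u).transpose = pullbackMetric Φ u := by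
  ext i j
  exact lorentz_comm _ _

lemma pullbackMetric_inv_comm (Φ : E → LM n) (u : E) (i j : Fin k) :
    (pullbackMetric Φ u)⁻¹ i j = (pullbackMetric Φ u)⁻¹ j i := by
  conv_lhs => rw [← pullbackMetric_transpose Φ u, ← Matrix.transpose_nonsing_inv]
  rfl

/-- Expanding each `∂g` by the product rule and using the symmetry of second derivatives, four of
the six terms cancel and the other two coincide, absorbing the factor `½`. -/
lemma christoffel_pullbackMetric {Φ : E → LM n} {u : E} (hΦ : ContDiffAt ℝ 2 Φ u)
    (l i j : Fin k) :
    christoffel (pullbackMetric Φ) l i j u =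
      ∑ m, (pullbackMetric Φ u)⁻¹ l m * lorentz (pd i (pd j Φ) u) (pd m Φ u) := by
  have hd : ∀ a, DifferentiableAt ℝ (pd a Φ) u := fun a =>
    (contDiffAt_pd hΦ a).differentiableAt (by norm_num)
  have key : ∀ a b c, pd a (fun v => pullbackMetric Φ v b c) u =
      lorentz (pd a (pd b Φ) u) (pd c Φ u) + lorentz (pd b Φ u) (pd a (pd c Φ) u) :=
    fun a b c => pd_lorentz (hd b) (hd c) a
  simp only [christoffel, key, Finset.mul_sum]
  refine Finset.sum_congr rfl fun m _ => ?_
  rw [pd_pd_comm hΦ j i, pd_pd_comm hΦ m i, pd_pd_comm hΦ m j,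
    lorentz_comm (pd i Φ u) (pd j (pd m Φ) u), lorentz_comm (pd j Φ u) (pd i (pd m Φ) u)]
  ring

/-- The component of `w` tangent to the parametrized submanifold `Φ` at `u`. -/
noncomputable def coordTangentPart (Φ : E → LM n) (u : E) (w : LM n) : LM n :=
  ∑ l, ∑ m, ((pullbackMetric Φ u)⁻¹ l m * lorentz w (pd l Φ u)) • pd m Φ u

/-- The coordinate Hessian of `Φ` is thus the component of `∂ᵢ∂ⱼΦ` normal to the submanifold. -/
lemma sum_christoffel_smul_pd {Φ : E → LM n} {u : E} (hΦ : ContDiffAt ℝ 2 Φ u) (i j : Fin k) :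
    ∑ l, christoffel (pullbackMetric Φ) l i j u • pd l Φ u =
      coordTangentPart Φ u (pd i (pd j Φ) u) := by
  simp only [christoffel_pullbackMetric hΦ, coordTangentPart, Finset.sum_smul]
  rw [Finset.sum_comm]
  refine Finset.sum_congr rfl fun l _ => Finset.sum_congr rfl fun m _ => ?_
  rw [pullbackMetric_inv_comm]

lemma coordTangentPart_sub_smul {Φ : E → LM n} {u : E} {ν : LM n}
    (hν : ∀ i, lorentz ν (pd i Φ u) = 0) (w : LM n) (c : ℝ) :
    coordTangentPart Φ u (w - c • ν) = coordTangentPart Φ u w := by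
  have : ∀ l, lorentz (w - c • ν) (pd l Φ u) = lorentz w (pd l Φ u) := by
    intro l
    rw [← lorentzL_apply, map_sub, map_smul]
    simp [lorentzL_apply, hν]
  simp only [coordTangentPart, this]

/-- If the trace of the projected second fundamental form vanishes, the vector Laplacian is
parallel to the direction that is projected away. -/
lemma vecLaplacian_eq_smul {Φ : E → LM n} {u : E} (hΦ : ContDiffAt ℝ 2 Φ u) {ν : LM n}
    (hν : ∀ i, lorentz ν (pd i Φ u) = 0) (c : LM n → ℝ)
    (h0 : ∑ i, ∑ j, (pullbackMetric Φ u)⁻¹ i j •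
      ((pd i (pd j Φ) u - c (pd i (pd j Φ) u) • ν) -
        coordTangentPart Φ u (pd i (pd j Φ) u - c (pd i (pd j Φ) u) • ν)) = 0) :
    vecLaplacian (pullbackMetric Φ) Φ u =
      (∑ i, ∑ j, (pullbackMetric Φ u)⁻¹ i j * c (pd i (pd j Φ) u)) • ν := by
  -- Replacing `0` by the vanishing trace makes both sides double sums that agree term by term.
  rw [← sub_eq_zero, ← h0]
  simp only [vecLaplacian, sum_christoffel_smul_pd hΦ, coordTangentPart_sub_smul hν,
    Finset.sum_smul, ← Finset.sum_sub_distrib]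
  refine Finset.sum_congr rfl fun i _ => Finset.sum_congr rfl fun j _ => ?_
  rw [mul_smul]
  module

/-- This is the trace of `g⁻¹g = 1`, with the Lorentzian product split into its time and space
parts. -/
lemma sum_coordGradSq_sub {Φ : E → LM n} {u : E} (hΦ : DifferentiableAt ℝ Φ u)
    (hg : IsUnit (pullbackMetric Φ u).det) :
    ∑ j, coordGradSq (pullbackMetric Φ) (fun v => (Φ v).2 j) u =
      k + coordGradSq (pullbackMetric Φ) (fun v => (Φ v).1) u := by
  have h1 : ∀ i, pd i (fun v => (Φ v).1) u = (pd i Φ u).1 := fun i =>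
    pd_clm (ContinuousLinearMap.fst ℝ ℝ (EuclideanSpace ℝ (Fin (n + 1)))) hΦ i
  have h2 : ∀ a i, pd i (fun v => (Φ v).2 a) u = (pd i Φ u).2 a := fun a i =>
    pd_clm ((EuclideanSpace.proj a).comp
      (ContinuousLinearMap.snd ℝ ℝ (EuclideanSpace ℝ (Fin (n + 1))))) hΦ i
  have ht : ((pullbackMetric Φ u)⁻¹ * pullbackMetric Φ u).trace = k := by
    rw [Matrix.nonsing_inv_mul _ hg]; simp
  have ht' : ∑ i, ∑ j, (pullbackMetric Φ u)⁻¹ i j * lorentz (pd i Φ u) (pd j Φ u) = k := by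
    rw [← ht]
    simp only [Matrix.trace, Matrix.diag, Matrix.mul_apply]
    refine Finset.sum_congr rfl fun i _ => Finset.sum_congr rfl fun j _ => ?_
    rw [lorentz_comm]
    rfl
  simp only [coordGradSq, h1, h2]
  rw [← ht', Finset.sum_comm, ← Finset.sum_add_distrib]
  refine Finset.sum_congr rfl fun i _ => ?_
  rw [Finset.sum_comm, ← Finset.sum_add_distrib]
  refine Finset.sum_congr rfl fun j _ => ?_
  rw [← Finset.mul_sum, lorentz]
  ring

lemma coordGradSq_nonneg {g : E → Matrix (Fin k) (Fin k) ℝ} {u : E} (hg : (g u).PosDef)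
    (f : E → ℝ) : 0 ≤ coordGradSq g f u := by
  have := hg.inv.posSemidef.dotProduct_mulVec_nonneg (fun i => pd i f u)
  refine this.trans_eq ?_
  simp only [coordGradSq, dotProduct, Matrix.mulVec, Finset.mul_sum, Pi.star_apply, star_trivial]
  exact Finset.sum_congr rfl fun i _ => Finset.sum_congr rfl fun j _ => by ring

/-! ### Local maxima -/

/-- A positive second derivative would make `a` a local minimum as well, so `φ` would be locally
constant and its second derivative zero. -/
lemma deriv_deriv_nonpos_of_isLocalMax {φ : ℝ → ℝ} {a : ℝ} (h : IsLocalMax φ a)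
    (hc : ContinuousAt φ a) : deriv (deriv φ) a ≤ 0 := by
  by_contra! hpos
  have hmin := isLocalMin_of_deriv_deriv_pos hpos h.deriv_eq_zero hc
  have he : φ =ᶠ[𝓝 a] fun _ => φ a := by
    filter_upwards [h, hmin] with t h1 h2
    exact le_antisymm h1 h2
  have : deriv (deriv φ) a = 0 := by
    rw [he.deriv.deriv_eq]
    simp
  linarith

/-- Restriction to the line `t ↦ u + t • v` reduces this to one variable. -/
lemma fderiv_fderiv_nonpos_of_isLocalMax {X : Type*} [NormedAddCommGroup X] [NormedSpace ℝ X]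
    {f : X → ℝ} {u : X} (h : IsLocalMax f u) (hf : ContDiffAt ℝ 2 f u) (v : X) :
    fderiv ℝ (fderiv ℝ f) u v v ≤ 0 := by
  set L : ℝ → X := fun t => u + t • v with hL
  have hL0 : L 0 = u := by simp [hL]
  have hLd : ∀ t, HasDerivAt L v t := fun t => by
    simpa [hL] using ((hasDerivAt_id t).smul_const v).const_add u
  have hLc : Tendsto L (𝓝 0) (𝓝 u) := by
    simpa only [hL0] using (hLd 0).continuousAt.tendsto
  have h1 : IsLocalMax (f ∘ L) 0 := by
    have := hLc.eventually h
    simpa only [IsLocalMax, IsMaxFilter, Function.comp, hL0] using this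
  have e : deriv (f ∘ L) =ᶠ[𝓝 0] fun t => fderiv ℝ f (L t) v := by
    filter_upwards [hLc.eventually (hf.eventually (by simp))] with t ht
    exact ((ht.differentiableAt (by norm_num)).hasFDerivAt.comp_hasDerivAt t (hLd t)).deriv
  have hd : HasFDerivAt (fderiv ℝ f) (fderiv ℝ (fderiv ℝ f) u) (L 0) := by
    rw [hL0]
    exact ((hf.fderiv_right (m := 1) (by norm_num)).differentiableAt (by norm_num)).hasFDerivAt
  have hd2 : HasDerivAt (fun t => fderiv ℝ f (L t) v) (fderiv ℝ (fderiv ℝ f) u v v) 0 := by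
    simpa using (hd.comp_hasDerivAt 0 (hLd 0)).clm_apply (hasDerivAt_const (0 : ℝ) v)
  have := deriv_deriv_nonpos_of_isLocalMax h1
    (ContinuousAt.comp (by rw [hL0]; exact hf.continuousAt) (hLd 0).continuousAt)
  rwa [e.deriv_eq, hd2.deriv] at this

/-- At a critical point the Christoffel terms drop out. Writing `g⁻¹ = ∑ₐ AₐAₐᵀ` turns the Laplacian
into a sum of second derivatives along the vectors `Aₐ`, each nonpositive. -/
lemma coordLaplacian_nonpos_of_isLocalMax {g : E → Matrix (Fin k) (Fin k) ℝ} {u : E}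
    (hg : (g u).PosDef) {f : E → ℝ} (h : IsLocalMax f u) (hf : ContDiffAt ℝ 2 f u) :
    coordLaplacian g f u ≤ 0 := by
  obtain ⟨m, A, hA⟩ := Matrix.posSemidef_iff_eq_sum_vecMulVec.mp hg.inv.posSemidef
  have h0 : ∀ i, pd i f u = 0 := fun i => by simp [pd, h.fderiv_eq_zero]
  have hG : ∀ i j, (g u)⁻¹ i j = ∑ a, A a i * A a j := fun i j => by
    rw [hA]; simp [Matrix.sum_apply, Matrix.vecMulVec_apply]
  have hsum : ∀ a, ∑ i, ∑ j, A a i * A a j * pd i (pd j f) u =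
      fderiv ℝ (fderiv ℝ f) u (∑ i, A a i • EuclideanSpace.single i (1 : ℝ))
        (∑ i, A a i • EuclideanSpace.single i (1 : ℝ)) := fun a => by
    simp only [pd_pd_apply hf, map_sum, map_smul, _root_.sum_apply,
      _root_.smul_apply, smul_eq_mul, Finset.mul_sum]
    rw [Finset.sum_comm]
    refine Finset.sum_congr rfl fun i _ => Finset.sum_congr rfl fun j _ => by ring
  have : coordLaplacian g f u = ∑ a, ∑ i, ∑ j, A a i * A a j * pd i (pd j f) u := by
    simp only [coordLaplacian, coordHess, h0, mul_zero, Finset.sum_const_zero, sub_zero, hG,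
      Finset.sum_mul]
    rw [Finset.sum_comm (s := (Finset.univ : Finset (Fin m)))]
    refine Finset.sum_congr rfl fun i _ => ?_
    rw [Finset.sum_comm]
  rw [this]
  exact Finset.sum_nonpos fun a _ => (hsum a).trans_le (fderiv_fderiv_nonpos_of_isLocalMax h hf _)

end Coordinates

/-! ### Regularity and positive definiteness in the preferred chart -/

section Immersion

variable {n k : ℕ} {M : Type*} [TopologicalSpace M] [ChartedSpace (EuclideanSpace ℝ (Fin k)) M]

lemma IsAdmissible.contDiffAt {J : Set ℝ} {r : ℝ → ℝ} (hr : IsAdmissible J r) {t : ℝ}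
    (ht : t ∈ J) : ContDiffAt ℝ 2 r t :=
  (hr.contDiffOn.contDiffAt (hr.isOpen.mem_nhds ht)).of_le (WithTop.coe_le_coe.2 le_top)

lemma IsAdmissible.deriv_sq_lt_one {J : Set ℝ} {r : ℝ → ℝ} (hr : IsAdmissible J r) {t : ℝ}
    (ht : t ∈ J) : deriv r t ^ 2 < 1 :=
  (sq_lt_one_iff_abs_lt_one _).2 (hr.abs_deriv_lt_one t ht)

lemma IsSpacelikeImmersion.contDiffAt_inChart {Ψ : M → LM n}
    (hΨ : IsSpacelikeImmersion (k := k) Ψ) (x : M) :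
    ContDiffAt ℝ 2 (inChart (k := k) x Ψ) (extChartAt (𝓡 k) x x) := by
  have h := (contMDiffAt_iff.1 (hΨ.contMDiff x)).2
  simp only [mfld_simps, modelWithCornersSelf_coe, Set.range_id, contDiffWithinAt_univ] at h
  exact ContDiffAt.of_le h (WithTop.coe_le_coe.2 le_top)

lemma IsSpacelikeImmersion.mfderiv_eq_fderiv_inChart {Ψ : M → LM n}
    (hΨ : IsSpacelikeImmersion (k := k) Ψ) (x : M) (v : EuclideanSpace ℝ (Fin k)) :
    mfderiv (𝓡 k) 𝓘(ℝ, LM n) Ψ x v =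
      fderiv ℝ (inChart (k := k) x Ψ) (extChartAt (𝓡 k) x x) v := by
  have h : MDifferentiableAt (𝓡 k) 𝓘(ℝ, LM n) Ψ x := (hΨ.contMDiff x).mdifferentiableAt (by simp)
  rw [h.mfderiv]
  simp only [modelWithCornersSelf_coe, Set.range_id, fderivWithin_univ]
  rfl

lemma IsSpacelikeImmersion.posDef_pullbackMetric {Ψ : M → LM n}
    (hΨ : IsSpacelikeImmersion (k := k) Ψ) (x : M) :
    (pullbackMetric (inChart (k := k) x Ψ) (extChartAt (𝓡 k) x x)).PosDef := by
  refine Matrix.PosDef.of_dotProduct_mulVec_pos ?_ fun v hv => ?_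
  · rw [Matrix.IsHermitian, Matrix.conjTranspose_eq_transpose_of_trivial]
    exact pullbackMetric_transpose _ _
  · set w : EuclideanSpace ℝ (Fin k) := ∑ i, v i • EuclideanSpace.single i (1 : ℝ) with hw
    have hwv : ∀ i, w i = v i := fun i => by
      simp [hw, Pi.single_apply]
    have hw0 : w ≠ 0 := fun h => hv <| by
      ext i
      rw [← hwv, h]
      rfl
    have h := hΨ.pos x w hw0
    rw [hΨ.mfderiv_eq_fderiv_inChart] at h
    refine h.trans_eq ?_
    rw [← lorentzL_apply, hw]
    simp only [map_sum, map_smul, _root_.sum_apply, _root_.smul_apply, lorentzL_apply,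
      smul_eq_mul, dotProduct, Matrix.mulVec, Finset.mul_sum, Pi.star_apply, star_trivial]
    rw [Finset.sum_comm]
    refine Finset.sum_congr rfl fun i _ => Finset.sum_congr rfl fun j _ => ?_
    rw [pullbackMetric, Matrix.of_apply, pd, pd]
    ring

end Immersion

/-! ### Parametrizations with values in `Q(r)` -/

section Coordinates

variable {k n : ℕ}

variable {J : Set ℝ} {r : ℝ → ℝ} {Φ : EuclideanSpace ℝ (Fin k) → LM n}
  {u : EuclideanSpace ℝ (Fin k)}

lemma contDiffAt_fst_comp (hΦ : ContDiffAt ℝ 2 Φ u) : ContDiffAt ℝ 2 (fun v => (Φ v).1) u :=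
  contDiff_fst.contDiffAt.comp u hΦ

lemma contDiffAt_snd_comp (hΦ : ContDiffAt ℝ 2 Φ u) (j : Fin (n + 1)) :
    ContDiffAt ℝ 2 (fun v => (Φ v).2 j) u :=
  ((EuclideanSpace.proj (𝕜 := ℝ) j).comp
    (ContinuousLinearMap.snd ℝ ℝ (EuclideanSpace ℝ (Fin (n + 1))))).contDiff.contDiffAt.comp u hΦ

lemma IsAdmissible.contDiffAt_sq (hr : IsAdmissible J r) {t : ℝ} (ht : t ∈ J) :
    ContDiffAt ℝ 2 (fun s => r s ^ 2) t :=
  (hr.contDiffAt ht).pow 2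

lemma IsAdmissible.deriv_sq (hr : IsAdmissible J r) {t : ℝ} (ht : t ∈ J) :
    deriv (fun s => r s ^ 2) t = 2 * (r t * deriv r t) := by
  have h := (((hr.contDiffAt ht).differentiableAt (by norm_num)).hasDerivAt.pow 2).deriv
  erw [h]
  simp
  ring

lemma IsAdmissible.deriv_deriv_sq (hr : IsAdmissible J r) {t : ℝ} (ht : t ∈ J) :
    deriv (deriv fun s => r s ^ 2) t = 2 * (deriv r t ^ 2 + r t * deriv (deriv r) t) := by
  have e : deriv (fun s => r s ^ 2) =ᶠ[𝓝 t] fun s => 2 * (r s * deriv r s) := by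
    filter_upwards [hr.isOpen.mem_nhds ht] with s hs
    exact hr.deriv_sq hs
  have h1 := ((hr.contDiffAt ht).differentiableAt (by norm_num)).hasDerivAt
  have h2 : HasDerivAt (deriv r) (deriv (deriv r) t) t := by
    have : ContDiffAt ℝ 1 (deriv r) t :=
      ((hr.contDiffAt ht).fderiv_right (m := 1) (by norm_num)).clm_apply contDiffAt_const
    exact (this.differentiableAt (by norm_num)).hasDerivAt
  have : HasDerivAt (fun s => 2 * (r s * deriv r s)) _ t := (h1.mul h2).const_mul 2
  rw [e.deriv_eq, this.deriv]
  ring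

/-- The vector field `(r'(t) r(t), x)` is normal to every submanifold of `Q(r)`. -/
lemma lorentz_normal_pd (hr : IsAdmissible J r) (hΦ : ContDiffAt ℝ 2 Φ u)
    (hQ : ∀ v, Φ v ∈ Q n J r) (i : Fin k) :
    lorentz (deriv r (Φ u).1 * r (Φ u).1, (Φ u).2) (pd i Φ u) = 0 := by
  have hd := hΦ.differentiableAt (by norm_num)
  have h1 : pd i (fun v => (Φ v).1) u = (pd i Φ u).1 :=
    pd_clm (ContinuousLinearMap.fst ℝ ℝ (EuclideanSpace ℝ (Fin (n + 1)))) hd i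
  have h2 : ∀ a, pd i (fun v => (Φ v).2 a) u = (pd i Φ u).2 a := fun a =>
    pd_clm ((EuclideanSpace.proj a).comp
      (ContinuousLinearMap.snd ℝ ℝ (EuclideanSpace ℝ (Fin (n + 1))))) hd i
  have hl : pd i (fun v => ∑ j, (Φ v).2 j ^ 2) u = ∑ j, 2 * ((Φ u).2 j * (pd i Φ u).2 j) := by
    have hj : ∀ j, pd i (fun v => (Φ v).2 j ^ 2) u = 2 * ((Φ u).2 j * (pd i Φ u).2 j) := fun j => by
      rw [pd_comp (h := fun s => s ^ 2) (by fun_prop)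
        ((contDiffAt_snd_comp hΦ j).differentiableAt (by norm_num)), h2]
      simp
      ring
    rw [pd, fderiv_fun_sum fun j _ =>
      ((contDiffAt_snd_comp hΦ j).pow 2).differentiableAt (by norm_num), _root_.sum_apply]
    exact Finset.sum_congr rfl fun j _ => hj j
  have hR : pd i (fun v => r (Φ v).1 ^ 2) u =
      2 * (r (Φ u).1 * deriv r (Φ u).1) * (pd i Φ u).1 := by
    rw [pd_comp (h := fun s => r s ^ 2) ((hr.contDiffAt_sq (hQ u).1).differentiableAt (by norm_num))
      ((contDiffAt_fst_comp hΦ).differentiableAt (by norm_num)), h1, hr.deriv_sq (hQ u).1]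
  -- Differentiating the equation of `Q(r)` is the whole argument: `hl` and `hR` compute the
  -- derivatives of its two sides.
  have he : (fun v => ∑ j, (Φ v).2 j ^ 2) = fun v => r (Φ v).1 ^ 2 := funext fun v => (hQ v).2
  rw [he, hR, ← Finset.mul_sum] at hl
  simp only [lorentz]
  linarith

/-- The two expressions of the Laplacian of `r(Φ₀)² = ∑ Φⱼ²` when the vector Laplacian of `Φ` is a
multiple of the normal direction. -/
lemma laplacian_sq_radius (hr : IsAdmissible J r) (hΦ : ContDiffAt ℝ 2 Φ u)
    (hQ : ∀ v, Φ v ∈ Q n J r) (g : EuclideanSpace ℝ (Fin k) → Matrix (Fin k) (Fin k) ℝ) {c : ℝ}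
    (hc : vecLaplacian g Φ u = c • (deriv r (Φ u).1 * r (Φ u).1, (Φ u).2)) :
    (1 / 2) * coordLaplacian g (fun v => r (Φ v).1 ^ 2) u =
        ∑ j, coordGradSq g (fun v => (Φ v).2 j) u + c * r (Φ u).1 ^ 2 ∧
      (1 / 2) * coordLaplacian g (fun v => r (Φ v).1 ^ 2) u =
        (deriv r (Φ u).1 ^ 2 + r (Φ u).1 * deriv (deriv r) (Φ u).1) *
            coordGradSq g (fun v => (Φ v).1) u +
          c * (r (Φ u).1 ^ 2 * deriv r (Φ u).1 ^ 2) := by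
  have h1 : coordLaplacian g (fun v => (Φ v).1) u = c * (deriv r (Φ u).1 * r (Φ u).1) := by
    have := coordLaplacian_clm g (ContinuousLinearMap.fst ℝ ℝ (EuclideanSpace ℝ (Fin (n + 1)))) hΦ
    rw [hc] at this
    simpa using this
  have h2 : ∀ j, coordLaplacian g (fun v => (Φ v).2 j) u = c * (Φ u).2 j := fun j => by
    have := coordLaplacian_clm g ((EuclideanSpace.proj j).comp
      (ContinuousLinearMap.snd ℝ ℝ (EuclideanSpace ℝ (Fin (n + 1))))) hΦ
    rw [hc] at this
    simpa using this
  constructor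
  · have he : (fun v => r (Φ v).1 ^ 2) = fun v => ∑ j, (Φ v).2 j ^ 2 :=
      funext fun v => (hQ v).2.symm
    rw [he, coordLaplacian_sum g _ fun j _ => (contDiffAt_snd_comp hΦ j).pow 2, ← (hQ u).2,
      Finset.mul_sum, Finset.mul_sum, ← Finset.sum_add_distrib]
    refine Finset.sum_congr rfl fun j _ => ?_
    rw [coordLaplacian_comp g (h := fun s => s ^ 2) (by fun_prop) (contDiffAt_snd_comp hΦ j), h2]
    have hd : deriv (fun s : ℝ => s ^ 2) = fun s => 2 * s := by
      ext s; simp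
    have hdd : deriv (fun s : ℝ => 2 * s) ((Φ u).2 j) = 2 := by
      rw [deriv_const_mul_field]; simp
    rw [hd, hdd]
    ring
  · rw [coordLaplacian_comp g (h := fun s => r s ^ 2) (hr.contDiffAt_sq (hQ u).1)
      (contDiffAt_fst_comp hΦ), h1, hr.deriv_sq (hQ u).1, hr.deriv_deriv_sq (hQ u).1]
    ring

end Coordinates

/-! ### Stationary immersions and the global identity -/

section Stationary

variable {n k : ℕ} {M : Type*} [TopologicalSpace M] [ChartedSpace (EuclideanSpace ℝ (Fin k)) M]
  {J : Set ℝ} {r : ℝ → ℝ} {Ψ : M → LM n}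

/-- For a stationary immersion, the vector Laplacian of `Ψ` is normal to `Q(r)`. -/
lemma IsStationary.exists_vecLaplacian_eq (hk : 1 ≤ k) (hr : IsAdmissible J r)
    (hΨ : IsSpacelikeImmersion (k := k) Ψ) (hQ : ∀ x, Ψ x ∈ Q n J r)
    (hst : IsStationary k r Ψ) (x : M) :
    ∃ c : ℝ, vecLaplacian (pullbackMetric (inChart (k := k) x Ψ)) (inChart (k := k) x Ψ)
      (extChartAt (𝓡 k) x x) = c • (deriv r (Ψ x).1 * r (Ψ x).1, (Ψ x).2) := by
  have hu : inChart (k := k) x Ψ (extChartAt (𝓡 k) x x) = Ψ x := by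
    simp only [inChart, extChartAt_to_inv]
  have hΦ := hΨ.contDiffAt_inChart x
  have hN : ∀ i, lorentz (unitNormal r (Ψ x))
      (pd i (inChart (k := k) x Ψ) (extChartAt (𝓡 k) x x)) = 0 := fun i => by
    -- The inverse chart is a total function into `M`, so `inChart x Ψ` takes values in `Q(r)` even
    -- off the chart target.
    have h := lorentz_normal_pd hr hΦ (fun v => hQ _) i
    rw [hu] at h
    rw [unitNormal, ← lorentzL_apply, map_smul, _root_.smul_apply, lorentzL_apply, h, smul_zero]
  have h0 := (smul_eq_zero.1 (hst x)).resolve_left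
    (one_div_ne_zero (Nat.cast_ne_zero.2 (by omega)))
  -- The normalizing factor of `unitNormal` is absorbed into `c`, whose value is not needed here.
  rw [vecLaplacian_eq_smul hΦ hN (fun w => lorentz w (unitNormal r (Ψ x))) h0, unitNormal, smul_smul]
  exact ⟨_, rfl⟩

/-- The identity `½ Δ r(Ψ₀)² + q r(Ψ₀)² = ∑ ‖∇Ψⱼ‖²` for stationary spacelike immersions. -/
lemma IsStationary.half_laplacian_add (hk : 1 ≤ k) (hr : IsAdmissible J r)
    (hΨ : IsSpacelikeImmersion (k := k) Ψ) (hQ : ∀ x, Ψ x ∈ Q n J r)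
    (hst : IsStationary k r Ψ) (x : M) :
    (1 / 2) * laplacian (k := k) Ψ (fun y => r (Ψ y).1 ^ 2) x + qFun k r Ψ x * r (Ψ x).1 ^ 2 =
      ∑ j, gradSq (k := k) Ψ (fun y => (Ψ y).2 j) x := by
  have hu : inChart (k := k) x Ψ (extChartAt (𝓡 k) x x) = Ψ x := by
    simp only [inChart, extChartAt_to_inv]
  have hΦ := hΨ.contDiffAt_inChart x
  obtain ⟨c, hc⟩ := hst.exists_vecLaplacian_eq hk hr hΨ hQ x
  rw [← hu] at hc
  obtain ⟨h1, h2⟩ := laplacian_sq_radius hr hΦ (fun v => hQ _) _ hc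
  have h3 := sum_coordGradSq_sub (hΦ.differentiableAt (by norm_num))
    (hΨ.posDef_pullbackMetric x).det_pos.ne'.isUnit
  rw [hu] at h1 h2
  -- After clearing the denominator, this is a linear combination of `h1`, `h2` and `h3`.
  have hq : qFun k r Ψ x = -c := by
    have hpos := hr.pos _ (hQ x).1
    have hlt := hr.deriv_sq_lt_one (hQ x).1
    have hne : r (Ψ x).1 ^ 2 * (1 - deriv r (Ψ x).1 ^ 2) ≠ 0 :=
      mul_ne_zero (pow_ne_zero _ hpos.ne') (by linarith)
    rw [qFun, div_eq_iff hne]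
    change (k - (deriv (deriv r) (Ψ x).1 * r (Ψ x).1 + deriv r (Ψ x).1 ^ 2 - 1) *
      coordGradSq (pullbackMetric (inChart (k := k) x Ψ))
        (fun v => (inChart (k := k) x Ψ v).1) (extChartAt (𝓡 k) x x)) = _
    linarith
  rw [hq]
  change (1 / 2) * coordLaplacian (pullbackMetric (inChart (k := k) x Ψ))
    (fun v => r (inChart (k := k) x Ψ v).1 ^ 2) (extChartAt (𝓡 k) x x) + _ = _
  rw [h1]
  change _ = ∑ j, coordGradSq (pullbackMetric (inChart (k := k) x Ψ))
    (fun v => (inChart (k := k) x Ψ v).2 j) (extChartAt (𝓡 k) x x)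
  ring

lemma IsSpacelikeImmersion.sum_gradSq_pos (hk : 1 ≤ k) (hΨ : IsSpacelikeImmersion (k := k) Ψ)
    (x : M) : 0 < ∑ j, gradSq (k := k) Ψ (fun y => (Ψ y).2 j) x := by
  have hg := hΨ.posDef_pullbackMetric x
  have h := sum_coordGradSq_sub ((hΨ.contDiffAt_inChart x).differentiableAt (by norm_num))
    hg.det_pos.ne'.isUnit
  have h0 := coordGradSq_nonneg hg (fun v => (inChart (k := k) x Ψ v).1)
  have hk' : (0 : ℝ) < k := by exact_mod_cast hk
  exact (add_pos_of_pos_of_nonneg hk' h0).trans_eq h.symm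

lemma IsSpacelikeImmersion.laplacian_nonpos_of_isLocalMax (hΨ : IsSpacelikeImmersion (k := k) Ψ)
    (f : M → ℝ) (x : M) (h : IsLocalMax f x)
    (hf : ContDiffAt ℝ 2 (inChart (k := k) x f) (extChartAt (𝓡 k) x x)) :
    laplacian (k := k) Ψ f x ≤ 0 := by
  refine coordLaplacian_nonpos_of_isLocalMax (hΨ.posDef_pullbackMetric x) ?_ hf
  have ht : Tendsto (extChartAt (𝓡 k) x).symm (𝓝 (extChartAt (𝓡 k) x x)) (𝓝 x) := by
    simpa only [extChartAt_to_inv] using (continuousAt_extChartAt_symm (I := 𝓡 k) x).tendsto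
  simpa only [IsLocalMax, IsMaxFilter, inChart, extChartAt_to_inv] using ht.eventually h

end Stationary

end SpacelikeRW

theorem mainTheorem9 (n k : ℕ) (hk : 1 ≤ k)
    (M : Type*) [TopologicalSpace M] [ChartedSpace (EuclideanSpace ℝ (Fin k)) M]
    [IsManifold (𝓡 k) ∞ M]
    (J : Set ℝ) (r : ℝ → ℝ) (hr : SpacelikeRW.IsAdmissible J r)
    (Ψ : M → SpacelikeRW.LM n) (hΨ : SpacelikeRW.IsSpacelikeImmersion (k := k) Ψ)
    (hQ : ∀ x, Ψ x ∈ SpacelikeRW.Q n J r)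
    (hst : SpacelikeRW.IsStationary k r Ψ) :
    (∀ x : M, IsLocalMax (fun y => r (Ψ y).1 ^ 2) x → 0 < SpacelikeRW.qFun k r Ψ x) ∧
    (∀ x : M,
      (1 / 2) * SpacelikeRW.laplacian (k := k) Ψ (fun y => r (Ψ y).1 ^ 2) x
          + SpacelikeRW.qFun k r Ψ x * r (Ψ x).1 ^ 2
        = ∑ j, SpacelikeRW.gradSq (k := k) Ψ (fun y => (Ψ y).2 j) x ∧
      0 < ∑ j, SpacelikeRW.gradSq (k := k) Ψ (fun y => (Ψ y).2 j) x) := by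
  have key := fun x => hst.half_laplacian_add hk hr hΨ hQ x
  have hpos := fun x => hΨ.sum_gradSq_pos hk x
  refine ⟨fun x hx => ?_, fun x => ⟨key x, hpos x⟩⟩
  have hf : ContDiffAt ℝ 2 (SpacelikeRW.inChart (k := k) x fun y => r (Ψ y).1 ^ 2)
      (extChartAt (𝓡 k) x x) := by
    refine ContDiffAt.comp (g := fun s => r s ^ 2) _ ?_
      (SpacelikeRW.contDiffAt_fst_comp (hΨ.contDiffAt_inChart x))
    exact hr.contDiffAt_sq (hQ _).1
  have hL := hΨ.laplacian_nonpos_of_isLocalMax _ x hx hf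
  have hq : 0 < SpacelikeRW.qFun k r Ψ x * r (Ψ x).1 ^ 2 := by linarith [key x, hpos x]
  exact pos_of_mul_pos_left hq (sq_nonneg _)
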